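/- Let $\Phi$ be a finite, reduced, irreducible crystallographic root system spanning the real vector space $\mathbb E$, endowed with a positive definite bilinear form invariant under the Weyl group. Let $\Pi$ be a set of simple roots of $\Phi$ and $\Phi^+$ the corresponding set of positive roots. Write $\gamma=\sum_{\alpha\in\Pi}c_\alpha(\gamma)\alpha$ for $\gamma\in\Phi$, and $\operatorname{supp}(\gamma)=\{\alpha\in\Pi: c_\alpha(\gamma)\neq 0\}$. The root poset is $\Phi^+$ ordered by: $\alpha\le\beta$ if and only if $\beta-\alpha$ is a nonnegative linear combination of positive roots. For $S\subseteq\Pi$ and $\beta\in\Phi$ put $$\Phi_{S,\beta}=\{\gamma\in\Phi : c_\alpha(\gamma)=c_\alpha(\beta)\text{ for all }\alpha\in S\},$$ $$\Phi_{S,\mathbb Z\beta}=\{\gamma\in\Phi : \exists\,k\in\mathbb Z\text{ with }c_\alpha(\gamma)=k\,c_\alpha(\beta)\text{ for all }\alpha\in S\};$$ the same notation is used for any root system $\Psi$ with a chosen simple system. A root subsystem of $\Phi$ is a subset stable under the reflections in its own elements; it is a root system in its linear span. Let $S\subseteq\Pi$ and $\beta\in\Phi^+$ with $\operatorname{supp}(\beta)\cap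 S\neq\emptyset$. Then: 1. $\Phi_{S,\mathbb Z\beta}$ is a root subsystem of $\Phi$. 2. $\Phi_{S,\beta}$ is an interval of the root poset, i.e. it is contained in $\Phi^+$, has a minimum and a maximum, and contains every root in between. Moreover, both $\{\min\Phi_{S,\beta}\}\cup(\Pi\setminus S)$ and $\{-\max\Phi_{S,\beta}\}\cup(\Pi\setminus S)$ are simple systems of $\Phi_{S,\mathbb Z\beta}$; in particular, $\min\Phi_{S,\beta}$ and $\max\Phi_{S,\beta}$ have the same length. 3. Let $\Psi=\Phi_{S,\mathbb Z\beta}$. If $\gamma=\min\Phi_{S,\beta}$ and $\{\gamma\}\cup(\Pi\setminus S)$ is chosen as the simple system of $\Psi$, then $\Phi_{S,\beta}=\Psi_{\{\gamma\},\gamma}$. If $\gamma=-\max\Phi_{S,\beta}$ and $\{\gamma\}\cup(\Pi\setminus S)$ is chosen as the simple system of $\Psi$, then $\Phi_{S,\beta}=-\Psi_{\{\gamma\},\gamma}$. -/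

import Mathlib

namespace RootStrata

open Module

variable {ι E N : Type*} [AddCommGroup E] [Module ℝ E] [AddCommGroup N] [Module ℝ N]
  {P : RootPairing ι ℝ E N}

/-- The coordinate `c_α(γ)` of the root `γ` with respect to the simple system `b`; by convention
it is `0` if `α` is not simple. -/
noncomputable def coord (b : P.Base) (α γ : ι) : ℝ :=
  open Classical in
  if h : α ∈ b.support then
    b.linearIndepOn_root.repr ⟨P.root γ, by
      have h1 : Set.range (fun x : (b.support : Set ι) ↦ P.root x) = P.root '' b.support := by
        rw [Set.image_eq_range]
      rw [h1, b.span_root_support]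
      exact Submodule.subset_span (Set.mem_range_self γ)⟩ ⟨α, h⟩
  else 0

/-- The defining property of the coordinates: `γ = ∑ c_α(γ) α`, the sum over all simple `α`. -/
theorem root_eq_sum_coord (b : P.Base) (γ : ι) :
    P.root γ = ∑ α ∈ b.support, coord b α γ • P.root α := by
  classical
  have hm : P.root γ ∈ Submodule.span ℝ
      (Set.range (fun x : (b.support : Set ι) ↦ P.root x)) := by
    have h1 : Set.range (fun x : (b.support : Set ι) ↦ P.root x) = P.root '' b.support := by
      rw [Set.image_eq_range]
    rw [h1, b.span_root_support]
    exact Submodule.subset_span (Set.mem_range_self γ)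
  have h := LinearIndependent.linearCombination_repr b.linearIndepOn_root ⟨P.root γ, hm⟩
  rw [Finsupp.linearCombination_apply, Finsupp.sum_fintype _ _ (by simp)] at h
  rw [← Finset.sum_coe_sort b.support]
  refine h.symm.trans (Finset.sum_congr rfl fun α _ ↦ ?_)
  rw [coord, dif_pos (show (α : ι) ∈ b.support from α.2)]

/-- The support of a root: the simple roots that occur in it with a nonzero coefficient. -/
def supp (b : P.Base) (γ : ι) : Set ι :=
  {α | α ∈ b.support ∧ coord b α γ ≠ 0}

/-- The set `Φ_{S,β}`, where `Φ` is the set of roots of `P` and `b` is its simple system `Π`. -/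
def stratum (b : P.Base) (S : Set ι) (β : ι) : Set ι :=
  {γ | ∀ α ∈ S, coord b α γ = coord b α β}

/-- The set `Φ_{S,ℤβ}`. -/
def intStratum (b : P.Base) (S : Set ι) (β : ι) : Set ι :=
  {γ | ∃ k : ℤ, ∀ α ∈ S, coord b α γ = k * coord b α β}

/-- A set of roots is a root subsystem if it is stable under the reflections in its own roots. -/
def IsRootSubsystem (P : RootPairing ι ℝ E N) (A : Set ι) : Prop :=
  ∀ i ∈ A, ∀ j ∈ A, P.reflectionPerm i j ∈ A

/-- A root subsystem is a root system in its own right: its roots and coroots are the restrictions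
to `A` of those of `P`, within the same ambient spaces. -/
noncomputable def subsystem (P : RootPairing ι ℝ E N) (A : Set ι) (hA : IsRootSubsystem P A) :
    RootPairing A ℝ E N where
  toLinearMap := P.toLinearMap
  isPerfPair_toLinearMap := P.isPerfPair_toLinearMap
  root := (Function.Embedding.subtype _).trans P.root
  coroot := (Function.Embedding.subtype _).trans P.coroot
  root_coroot_two i := P.root_coroot_two i
  reflectionPerm i :=
    { toFun := fun j ↦ ⟨P.reflectionPerm i j, hA i i.2 j j.2⟩
      invFun := fun j ↦ ⟨P.reflectionPerm i j, hA i i.2 j j.2⟩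
      left_inv := fun j ↦ Subtype.ext (P.reflectionPerm_involutive i j)
      right_inv := fun j ↦ Subtype.ext (P.reflectionPerm_involutive i j) }
  reflectionPerm_root i j := P.reflectionPerm_root i j
  reflectionPerm_coroot i j := P.reflectionPerm_coroot i j

/-- `Δ` is (the set of vectors of) a simple system of the root system `P`. -/
def IsSimpleSystem (P : RootPairing ι ℝ E N) (Δ : Set E) : Prop :=
  ∃ b : P.Base, P.root '' b.support = Δ

/-- The set `Φ⁺` of positive roots, the underlying set of the root poset. -/
def PosRoot (b : P.Base) : Type _ := {i : ι // b.IsPos i}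

/-- The underlying root of an element of the root poset. -/
def PosRoot.idx {b : P.Base} (x : PosRoot b) : ι := Subtype.val x

/-- There is a linear functional that is positive on all positive roots. -/
theorem exists_dual_pos (b : P.Base) : ∃ f : Dual ℝ E, ∀ i, b.IsPos i → 0 < f (P.root i) := by
  obtain ⟨f, hf⟩ : ∃ f : Dual ℝ E, ∀ i ∈ b.support, f (P.root i) = 1 := by
    have hli : LinearIndependent ℝ (fun x : (b.support : Set ι) ↦ P.root x) :=
      b.linearIndepOn_root
    obtain ⟨g, hg⟩ := LinearMap.exists_extend
      (hli.repr.comp LinearMap.id |> (Finsupp.linearCombination ℝ fun _ ↦ (1 : ℝ)).comp)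
    refine ⟨g, fun i hi ↦ ?_⟩
    have h1 := LinearMap.congr_fun hg ⟨P.root i, Submodule.subset_span ⟨⟨i, hi⟩, rfl⟩⟩
    have h2 := hli.repr_eq_single ⟨i, hi⟩ ⟨P.root i, Submodule.subset_span ⟨⟨i, hi⟩, rfl⟩⟩ rfl
    simpa [h2] using h1
  refine ⟨f, fun i hi ↦ ?_⟩
  obtain ⟨c, -, -, hc⟩ := b.exists_root_eq_sum_int i
  have h : f (P.root i) = ((b.height i : ℤ) : ℝ) := by
    rw [RootPairing.Base.height_eq_sum hc, hc, map_sum, Int.cast_sum]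
    refine Finset.sum_congr rfl fun j hj ↦ ?_
    rw [map_zsmul, hf j hj, zsmul_eq_mul, mul_one]
  rw [h]
  exact_mod_cast hi

/-- The root poset: `α ≤ β` if and only if `β - α` is a nonnegative linear combination of
positive roots. -/
instance (b : P.Base) : PartialOrder (PosRoot b) where
  le x y := P.root y.idx - P.root x.idx ∈ Submodule.span NNReal (P.root '' {i | b.IsPos i})
  le_refl x := by simp
  le_trans x y z hxy hyz := by
    have h := add_mem hyz hxy
    rwa [sub_add_sub_cancel] at h
  le_antisymm x y hxy hyx := by
    obtain ⟨f, hf⟩ := exists_dual_pos b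
    have key : ∀ v ∈ Submodule.span NNReal (P.root '' {i | b.IsPos i}), v = 0 ∨ 0 < f v := by
      intro v hv
      induction hv using Submodule.span_induction with
      | mem v hv =>
        obtain ⟨i, hi, rfl⟩ := hv
        exact Or.inr (hf i hi)
      | zero => exact Or.inl rfl
      | add u v _ _ hu hv =>
        rcases hu with rfl | hu
        · simpa using hv
        · rcases hv with rfl | hv
          · simpa using Or.inr hu
          · right
            rw [map_add]
            exact add_pos hu hv
      | smul a v _ hv =>
        rcases eq_or_ne a 0 with rfl | ha
        · exact Or.inl (zero_smul _ _)
        · rcases hv with rfl | hv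
          · exact Or.inl (smul_zero _)
          · right
            rw [NNReal.smul_def, map_smul, smul_eq_mul]
            exact mul_pos (NNReal.coe_pos.mpr (pos_iff_ne_zero.mpr ha)) hv
    have h0 : P.root y.idx - P.root x.idx = 0 := by
      rcases key _ hxy with h | h
      · exact h
      · rcases key _ hyx with h' | h'
        · rw [← neg_sub, h', neg_zero]
        · rw [← neg_sub, map_neg] at h'
          linarith
    exact Subtype.ext (P.root.injective (sub_eq_zero.mp h0).symm)

end RootStrata

/-!
Let `D = Π \ S` and `Ψ = Φ_{S,ℤβ}`. Choosing a simple root `α₀ ∈ S` in the support of `β`, the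
linear form `κ = c_{α₀} / c_{α₀}(β)` takes integral values on `Ψ`, vanishes on `D`, and
`Φ_{S,β} = {γ ∈ Ψ | κ γ = 1}`. Moreover every `γ ∈ Ψ` is congruent to `κ γ • β` modulo the span
of `D`, so `Ψ` has rank at most `|D| + 1`.

The heart of the proof is `exists_base_insert`. Order `Ψ` by the linear form `f = T κ + h` with `h`
the height and `T` large: a root is positive if `κ` is, and on the roots with `κ = 0` positivity is
the original one. The elements of `D` are then indecomposable, hence simple, for `f`; by the rank
bound there is at most one further simple root `g`, and there is one since `κ β = 1`. Writing `β` in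
terms of the simple roots forces `κ g = 1`, so every `γ ∈ Ψ` with `κ γ = 1` is `g` plus a sum of
elements of `D`. For `κ` this gives `g = min Φ_{S,β}`; for `-κ` it gives `g = -max Φ_{S,β}`.

Minimum and maximum have the same length by comparison of dominant vectors
(`exists_rootForm_le`): among the roots of `Φ_{S,β}` with the same length as the minimum, one of
maximal height is dominant for `D`, as is the maximum `M`, and the difference of the two is a sum of
elements of `D`; so `M` is at least as long. The same argument for `-Φ_{S,β}` gives the reverse
inequality, and equality of lengths forces the dominant root to be `M` itself.

Finally, in any simple system of `Ψ` made up of `γ = ±g` and `D`, the coordinate of a root at `γ` is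
`κ` up to sign (`mem_stratum_singleton_iff`), which gives the last two assertions.
-/

namespace RootStrata

open Module Set

variable {ι E N : Type*} [AddCommGroup E] [Module ℝ E] [AddCommGroup N] [Module ℝ N]
  {P : RootPairing ι ℝ E N}

/-! ### Completing a set of roots to a base by one root -/

theorem mem_closure_image_iff_coe {κ F : Type*} [AddCommGroup F] [Module ℝ F]
    {V : Submodule ℝ F} {v : κ → V} {s : Set κ} {x : V} :
    x ∈ AddSubmonoid.closure (v '' s) ↔
      (x : F) ∈ AddSubmonoid.closure ((fun i ↦ (v i : F)) '' s) := by
  have h : AddSubmonoid.closure ((fun i ↦ (v i : F)) '' s) =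
      (AddSubmonoid.closure (v '' s)).map V.subtype.toAddMonoidHom := by
    rw [AddMonoidHom.map_mclosure, image_image]
    rfl
  rw [h]
  exact (AddSubmonoid.mem_map_iff_mem (f := V.subtype.toAddMonoidHom) V.injective_subtype).symm

/-- A version of `RootPairing.Base.mk'` for root pairings whose roots need not span the ambient
space: a set of roots satisfying the axioms of a base for roots also satisfies them for coroots. -/
theorem exists_base_support_eq [Finite ι] (Q : RootPairing ι ℝ E N) [Q.IsCrystallographic]
    [Q.IsReduced] (s : Set ι) (hli : LinearIndepOn ℝ Q.root s)
    (hsp : ∀ i, Q.root i ∈ AddSubmonoid.closure (Q.root '' s) ∨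
      -Q.root i ∈ AddSubmonoid.closure (Q.root '' s)) :
    ∃ b : Q.Base, (b.support : Set ι) = s := by
  -- The condition on coroots is known for root systems, so pass to the spans of roots and coroots.
  have : Fintype ι := Fintype.ofFinite ι
  let Q' := Q.restrictScalars' ℝ
  have hpair (i j : ι) : Q'.pairing i j = Q.pairing i j := Q.restrictScalars_pairing ℝ i j
  have : Q'.IsCrystallographic := ⟨fun i j ↦ by
    rw [hpair]; exact RootPairing.IsValuedIn.exists_value i j⟩
  have hinj : Function.Injective (Submodule.span ℝ (range Q.root)).subtype :=
    Submodule.injective_subtype _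
  have : Q'.IsReduced := ⟨fun i j h ↦ by
    have h' : ¬ LinearIndependent ℝ ![Q.root i, Q.root j] := by
      contrapose h
      refine LinearIndependent.of_comp (Submodule.span ℝ (range Q.root)).subtype ?_
      have e : (Submodule.span ℝ (range Q.root)).subtype ∘ ![Q'.root i, Q'.root j] =
          ![Q.root i, Q.root j] := by
        ext k
        fin_cases k <;> rfl
      rwa [e]
    rcases RootPairing.IsReduced.eq_or_eq_neg (P := Q) i j h' with h' | h'
    · exact Or.inl (hinj h')
    · exact Or.inr (hinj h')⟩
  have hli' : LinearIndepOn ℝ Q'.root s :=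
    LinearIndependent.of_comp (Submodule.span ℝ (range Q.root)).subtype hli
  have hsp' (i : ι) : Q'.root i ∈ AddSubmonoid.closure (Q'.root '' s) ∨
      -Q'.root i ∈ AddSubmonoid.closure (Q'.root '' s) := by
    rw [mem_closure_image_iff_coe, mem_closure_image_iff_coe]
    exact hsp i
  have hco : LinearIndepOn ℝ Q.coroot s :=
    LinearIndependent.map' (Q'.linearIndepOn_coroot_iff.mpr hli')
      (Submodule.span ℝ (range Q.coroot)).subtype (Submodule.ker_subtype _)
  refine ⟨⟨s.toFinite.toFinset, by simpa using hli, by simpa using hco,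
    by simpa using hsp, fun i ↦ ?_⟩, by simp⟩
  have h := Q'.coroot_mem_or_neg_mem_closure_of_root s hli' hsp' i
  rw [mem_closure_image_iff_coe, mem_closure_image_iff_coe] at h
  rw [Finite.coe_toFinset]
  exact h

theorem mem_closure_image_insert {Q : RootPairing ι ℝ E N} {D : Set ι} {g : ι} {x : E}
    (hx : x ∈ AddSubmonoid.closure (Q.root '' insert g D)) :
    ∃ n : ℕ, x - n • Q.root g ∈ AddSubmonoid.closure (Q.root '' D) := by
  rw [image_insert_eq, insert_eq, AddSubmonoid.closure_union, AddSubmonoid.mem_sup] at hx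
  obtain ⟨y, hy, z, hz, rfl⟩ := hx
  obtain ⟨n, rfl⟩ := AddSubmonoid.mem_closure_singleton.mp hy
  exact ⟨n, by simpa using hz⟩

theorem map_eq_zero_of_mem_closure {Q : RootPairing ι ℝ E N} {D : Set ι} {κ : Dual ℝ E}
    (hκ : ∀ i ∈ D, κ (Q.root i) = 0) {x : E} (hx : x ∈ AddSubmonoid.closure (Q.root '' D)) :
    κ x = 0 := by
  induction hx using AddSubmonoid.closure_induction with
  | mem x hx => obtain ⟨i, hi, rfl⟩ := hx; exact hκ i hi
  | zero => simp
  | add x y _ _ hx hy => simp [hx, hy]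

theorem map_nonneg_of_mem_closure {Q : RootPairing ι ℝ E N} {D : Set ι} {κ : Dual ℝ E}
    (hκ : ∀ i ∈ D, 0 ≤ κ (Q.root i)) {x : E} (hx : x ∈ AddSubmonoid.closure (Q.root '' D)) :
    0 ≤ κ x := by
  induction hx using AddSubmonoid.closure_induction with
  | mem x hx => obtain ⟨i, hi, rfl⟩ := hx; exact hκ i hi
  | zero => simp
  | add x y _ _ hx hy => rw [map_add]; exact add_nonneg hx hy

/-- If `κ` is an integral linear form on the roots such that every root is congruent to a multiple
of `β` modulo the span of a set `D` of roots of height one with `κ = 0`, then `D` is completed to a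
base by a single root `g`. As `κ β = κ g = 1`, all roots with `κ = 1` are obtained from `g` by
adding elements of `D`. The form `h` plays the role of the height. -/
theorem exists_base_insert [Finite ι] (Q : RootPairing ι ℝ E N) [Q.IsCrystallographic]
    [Q.IsReduced] (κ h : Dual ℝ E) (D : Set ι) (β : ι)
    (hκ : ∀ i, ∃ k : ℤ, κ (Q.root i) = k) (hκβ : κ (Q.root β) = 1)
    (hκD : ∀ i ∈ D, κ (Q.root i) = 0) (hhD : ∀ i ∈ D, h (Q.root i) = 1)
    (hh : ∀ i, 0 < h (Q.root i) → 1 ≤ h (Q.root i)) (hh0 : ∀ i, h (Q.root i) ≠ 0)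
    (hspan : ∀ i, Q.root i - κ (Q.root i) • Q.root β ∈ Submodule.span ℝ (Q.root '' D)) :
    ∃ g, κ (Q.root g) = 1 ∧ (∃ b : Q.Base, (b.support : Set ι) = insert g D) ∧
      ∀ i, κ (Q.root i) = 1 → Q.root i - Q.root g ∈ AddSubmonoid.closure (Q.root '' D) := by
  -- For `T` exceeding all `|h|`, the sign of `T κ + h` is that of `κ` wherever `κ ≠ 0`.
  obtain ⟨T, hT⟩ : ∃ T : ℝ, ∀ i, |h (Q.root i)| < T := by
    obtain ⟨T, hT⟩ := (finite_range fun i ↦ |h (Q.root i)|).bddAbove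
    exact ⟨T + 1, fun i ↦ lt_of_le_of_lt (hT (mem_range_self i)) (lt_add_one T)⟩
  have hTpos : 0 < T := (abs_nonneg _).trans_lt (hT β)
  let f : Dual ℝ E := T • κ + h
  have hf (x : E) : f x = T * κ x + h x := rfl
  have hfpos (i : ι) (hi : 1 ≤ κ (Q.root i)) : 0 < f (Q.root i) := by
    rw [hf]
    have := (abs_lt.mp (hT i)).1
    nlinarith
  have hfneg (i : ι) (hi : κ (Q.root i) ≤ -1) : f (Q.root i) < 0 := by
    rw [hf]
    have := (abs_lt.mp (hT i)).2
    nlinarith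
  have hκcases (i : ι) : κ (Q.root i) ≤ -1 ∨ κ (Q.root i) = 0 ∨ 1 ≤ κ (Q.root i) := by
    obtain ⟨k, hk⟩ := hκ i
    rw [hk]
    rcases lt_trichotomy k 0 with h | h | h
    · left; exact_mod_cast Int.le_sub_one_of_lt h
    · right; left; exact_mod_cast h
    · right; right; exact_mod_cast h
  have hf0 (i : ι) : f (Q.root i) ≠ 0 := by
    rcases hκcases i with hi | hi | hi
    · exact (hfneg i hi).ne
    · rw [hf, hi]; simpa using hh0 i
    · exact (hfpos i hi).ne'
  have hκnonneg (i : ι) (hi : 0 < f (Q.root i)) : 0 ≤ κ (Q.root i) := by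
    rcases hκcases i with h' | h' | h'
    · exact absurd hi (hfneg i h').le.not_gt
    · exact h'.ge
    · linarith
  let _i := Q.indexNeg
  let B : Set ι := IsAddIndecomposable.baseOf Q.root (f : E →+ ℝ)
  have hB : LinearIndepOn ℝ Q.root B := Q.linearIndepOn_root_baseOf' f hf0
  have hBspan (i : ι) := IsAddIndecomposable.mem_or_neg_mem_closure_baseOf Q.root
    (f : E →+ ℝ) i (hf0 i) (by simp)
  have hBpos (i : ι) (hi : i ∈ B) : 0 < f (Q.root i) := hi.1
  have hclos (i : ι) (hi : 0 < f (Q.root i)) : Q.root i ∈ AddSubmonoid.closure (Q.root '' B) := by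
    refine (hBspan i).resolve_right fun h' ↦ ?_
    have := map_nonneg_of_mem_closure (fun i hi ↦ (hBpos i hi).le) h'
    rw [map_neg] at this
    linarith
  -- If `α ∈ D` were a sum of two `f`-positive roots, both would have `κ = 0`, hence `h ≥ 1`, while
  -- `h α = 1`.
  have hDB : D ⊆ B := by
    intro i hi
    refine ⟨show 0 < f (Q.root i) by rw [hf, hκD i hi, hhD i hi]; simp, ?_⟩
    intro j (hj : 0 < f (Q.root j)) k (hk : 0 < f (Q.root k)) hijk
    exfalso
    have e1 : κ (Q.root j) + κ (Q.root k) = 0 := by rw [← map_add, ← hijk, hκD i hi]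
    have e2 : h (Q.root j) + h (Q.root k) = 1 := by rw [← map_add, ← hijk, hhD i hi]
    have hj0 := hκnonneg j hj
    have hk0 := hκnonneg k hk
    have hj1 : κ (Q.root j) = 0 := by linarith
    have hk1 : κ (Q.root k) = 0 := by linarith
    have hj2 := hh j (by rw [hf, hj1] at hj; simpa using hj)
    have hk2 := hh k (by rw [hf, hk1] at hk; simpa using hk)
    linarith
  have hnot (g : ι) (hg : g ∈ B) (hgD : g ∉ D) :
      Q.root g ∉ Submodule.span ℝ (Q.root '' D) :=
    fun h' ↦ hgD ((hB.mono hDB).mem_span_iff.mp h' (hB.mono (insert_subset hg hDB)))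
  obtain ⟨g, hgB, hgD⟩ : ∃ g ∈ B, g ∉ D := by
    by_contra! hcon
    have hBD : B = D := subset_antisymm hcon hDB
    have h1 := hclos β (hfpos β hκβ.ge)
    rw [hBD] at h1
    have h2 := map_eq_zero_of_mem_closure hκD h1
    linarith
  -- Modulo the span of `D` all roots are multiples of `β`, so two simple roots outside `D` would be
  -- linearly dependent.
  have hBeq : B = insert g D := by
    refine subset_antisymm (fun g' hg' ↦ ?_) (insert_subset hgB hDB)
    by_contra hcon
    rw [mem_insert_iff, not_or] at hcon
    obtain ⟨hne, hg'D⟩ := hcon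
    have h1 : κ (Q.root g) • Q.root g' - κ (Q.root g') • Q.root g ∈
        Submodule.span ℝ (Q.root '' D) := by
      have := sub_mem (Submodule.smul_mem _ (κ (Q.root g)) (hspan g'))
        (Submodule.smul_mem _ (κ (Q.root g')) (hspan g))
      convert this using 1
      module
    have hg0 : κ (Q.root g) ≠ 0 := fun h0 ↦ hnot g hgB hgD (by simpa [h0] using hspan g)
    have h2 : Q.root g' ∈ Submodule.span ℝ (Q.root '' insert g D) := by
      rw [image_insert_eq, Submodule.mem_span_insert]
      refine ⟨(κ (Q.root g))⁻¹ * κ (Q.root g'), _, Submodule.smul_mem _ (κ (Q.root g))⁻¹ h1, ?_⟩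
      rw [smul_sub, smul_smul, smul_smul, inv_mul_cancel₀ hg0]
      module
    rcases (hB.mono (insert_subset hgB hDB)).mem_span_iff.mp h2
      (hB.mono (insert_subset hg' (insert_subset hgB hDB))) with h3 | h3
    · exact hne h3
    · exact hg'D h3
  -- With `κ i = 1`, applying `κ` to an expansion `i = n • g + d` gives `n * κ g = 1`. As `n ≥ 0`
  -- and `κ g` is an integer, both equal `1`.
  have hcoef (i : ι) (hi : κ (Q.root i) = 1) : ∃ n : ℕ, (n : ℝ) * κ (Q.root g) = 1 ∧
      Q.root i - n • Q.root g ∈ AddSubmonoid.closure (Q.root '' D) := by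
    have h1 := hclos i (hfpos i hi.ge)
    rw [hBeq] at h1
    obtain ⟨n, hn⟩ := mem_closure_image_insert h1
    have h2 := map_eq_zero_of_mem_closure hκD hn
    rw [map_sub, hi, map_nsmul, nsmul_eq_mul] at h2
    exact ⟨n, by linarith, hn⟩
  have hg1 : κ (Q.root g) = 1 := by
    obtain ⟨n, hn, -⟩ := hcoef β hκβ
    obtain ⟨k, hk⟩ := hκ g
    rw [hk] at hn ⊢
    have hn' : (n : ℤ) * k = 1 := by exact_mod_cast hn
    have hn1 := Int.eq_one_of_mul_eq_one_right (Int.natCast_nonneg n) hn'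
    have : k = 1 := by rwa [hn1, one_mul] at hn'
    exact_mod_cast this
  refine ⟨g, hg1, ?_, fun i hi ↦ ?_⟩
  · rw [← hBeq]
    exact exists_base_support_eq Q B hB hBspan
  · obtain ⟨n, hn, hn'⟩ := hcoef i hi
    rw [hg1, mul_one] at hn
    have : n = 1 := by exact_mod_cast hn
    simpa [this] using hn'

/-! ### Lengths of extremal vectors -/

theorem rootForm_root_nonneg_iff [Fintype ι] (i : ι) (x : E) :
    0 ≤ P.RootForm (P.root i) x ↔ 0 ≤ P.toLinearMap x (P.coroot i) := by
  have h1 : 2 * P.RootForm (P.root i) x =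
      P.toLinearMap x (P.coroot i) * P.RootForm (P.root i) (P.root i) := by
    have h := P.rootForm_reflection_reflection_apply i (P.root i) x
    rw [P.reflection_apply_self, P.reflection_apply, map_neg, LinearMap.neg_apply, map_sub,
      map_smul, smul_eq_mul] at h
    change -(_ - P.toLinearMap x (P.coroot i) * _) = _ at h
    linarith
  have h2 : 0 < P.RootForm (P.root i) (P.root i) :=
    P.rootForm_pos_of_ne_zero (Submodule.subset_span (mem_range_self i)) (P.ne_zero i)
  rw [← mul_nonneg_iff_of_pos_right h2 (b := P.toLinearMap x (P.coroot i)), ← h1]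
  simp

/-- Let `Z` be stable under the reflections in `D` with a maximum `t`, in the sense that every
element of `Z` is `t` minus a sum of elements of `D`. Then `t` is longest in `Z` for the canonical form
`RootForm`. The second part holds because an element as long as `t` is in the orbit of `t`
under these reflections, so that it has the same length for every invariant form. -/
theorem exists_rootForm_le [Fintype ι] [P.IsRootSystem] (B : P.InvariantForm) (h : Dual ℝ E)
    {D : Set ι} (hD : ∀ i ∈ D, 0 < h (P.root i)) {Z : Set E} (hZ : Z.Finite)
    (hrefl : ∀ i ∈ D, ∀ z ∈ Z, P.reflection i z ∈ Z) {t : E} (ht : t ∈ Z)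
    (hle : ∀ z ∈ Z, t - z ∈ AddSubmonoid.closure (P.root '' D)) {x : E} (hx : x ∈ Z) :
    P.RootForm x x ≤ P.RootForm t t ∧
      (P.RootForm x x = P.RootForm t t → B.form x x = B.form t t) := by
  -- Reflections in `D` preserve both conditions on `y`, so by maximality none of them raises the
  -- height of `y`, which makes `y` dominant with respect to `D`.
  obtain ⟨y, ⟨hyZ, hyB, hyR⟩, hymax⟩ :=
    (hZ.subset (sep_subset Z fun z ↦ B.form z z = B.form x x ∧
      P.RootForm z z = P.RootForm x x)).exists_maximalFor h _ ⟨x, hx, rfl, rfl⟩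
  have hdom (z : E) (i : ι) (hi : i ∈ D) (hz : h (P.reflection i z) ≤ h z) :
      0 ≤ P.RootForm (P.root i) z := by
    rw [rootForm_root_nonneg_iff]
    rw [P.reflection_apply, map_sub, map_smul, smul_eq_mul] at hz
    change _ - P.toLinearMap z (P.coroot i) * _ ≤ _ at hz
    exact nonneg_of_mul_nonneg_left (by linarith) (hD i hi)
  have hdom_y (i : ι) (hi : i ∈ D) : 0 ≤ P.RootForm.flip y (P.root i) := by
    refine hdom y i hi (le_of_not_gt fun hlt ↦ ?_)
    refine hlt.not_ge (hymax ⟨hrefl i hi y hyZ, ?_, ?_⟩ hlt.le)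
    · rw [B.apply_reflection_reflection, hyB]
    · rw [P.rootForm_reflection_reflection_apply, hyR]
  have hdom_t (i : ι) (hi : i ∈ D) : 0 ≤ P.RootForm.flip t (P.root i) := by
    refine hdom t i hi ?_
    have := map_nonneg_of_mem_closure (fun i hi ↦ (hD i hi).le) (hle _ (hrefl i hi t ht))
    rw [map_sub] at this
    linarith
  have h1 : 0 ≤ P.RootForm (t - y) y := map_nonneg_of_mem_closure hdom_y (hle y hyZ)
  have h2 : 0 ≤ P.RootForm (t - y) t := map_nonneg_of_mem_closure hdom_t (hle y hyZ)
  have hsymm : P.RootForm t y = P.RootForm y t := (P.rootForm_symmetric.eq y t).symm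
  simp only [map_sub, LinearMap.sub_apply] at h1 h2
  refine ⟨by linarith, fun heq ↦ ?_⟩
  -- Equality of the lengths makes `t - y` orthogonal to both `t` and `y`.
  have h3 : P.RootForm (t - y) (t - y) = 0 := by
    simp only [map_sub, LinearMap.sub_apply]
    linarith
  have h4 : t - y = 0 := P.rootForm_anisotropic _ h3
  rw [← hyB, sub_eq_zero.mp h4]

theorem form_eq_of_least_of_greatest [Finite ι] [P.IsRootSystem] (B : P.InvariantForm)
    (h : Dual ℝ E) {D : Set ι} (hD : ∀ i ∈ D, 0 < h (P.root i)) {Z : Set E} (hZ : Z.Finite)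
    (hrefl : ∀ i ∈ D, ∀ z ∈ Z, P.reflection i z ∈ Z) {s t : E} (hs : s ∈ Z) (ht : t ∈ Z)
    (hsle : ∀ z ∈ Z, z - s ∈ AddSubmonoid.closure (P.root '' D))
    (hlet : ∀ z ∈ Z, t - z ∈ AddSubmonoid.closure (P.root '' D)) :
    B.form s s = B.form t t := by
  have : Fintype ι := Fintype.ofFinite ι
  obtain ⟨h1, h2⟩ := exists_rootForm_le B h hD hZ hrefl ht hlet hs
  -- The set `-Z` has maximum `-s`.
  obtain ⟨h3, -⟩ := exists_rootForm_le B h hD (Z := -Z) hZ.neg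
    (fun i hi z hz ↦ by
      rw [mem_neg, ← map_neg]
      exact hrefl i hi _ hz) (t := -s) (by simpa using hs)
    (fun z hz ↦ by simpa [sub_eq_add_neg, add_comm] using hsle _ hz) (x := -t) (by simpa using ht)
  simp only [map_neg, LinearMap.neg_apply, neg_neg] at h3
  exact h2 (le_antisymm h1 h3)

/-! ### Coordinates with respect to a base -/

theorem map_root_eq_sum (b : P.Base) (κ : Dual ℝ E) (i : ι) :
    κ (P.root i) = ∑ α ∈ b.support, coord b α i * κ (P.root α) := by
  conv_lhs => rw [root_eq_sum_coord b i]
  simp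

theorem exists_dual_coord [P.IsRootSystem] (b : P.Base) {α : ι} (hα : α ∈ b.support) :
    ∃ c : Dual ℝ E, (∀ i, c (P.root i) = coord b α i) ∧ c (P.root α) = 1 ∧
      ∀ i ∈ b.support, i ≠ α → c (P.root i) = 0 := by
  let c := b.toWeightBasis.coord ⟨α, hα⟩
  have hc1 : c (P.root α) = 1 := by
    have := b.toWeightBasis_repr_root ⟨α, hα⟩
    simp_all [c]
  have hc0 (i : ι) (hi : i ∈ b.support) (hne : i ≠ α) : c (P.root i) = 0 := by
    have := b.toWeightBasis_repr_root ⟨i, hi⟩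
    simp_all [c]
  refine ⟨c, fun i ↦ ?_, hc1, hc0⟩
  rw [map_root_eq_sum b, Finset.sum_eq_single_of_mem α hα, hc1, mul_one]
  intro j hj hne
  rw [hc0 j hj hne, mul_zero]

theorem coord_of_root_eq_add_smul [P.IsRootSystem] {b : P.Base} {α i j k : ι} {z : ℝ}
    (hα : α ∈ b.support) (hk : P.root k = P.root i + z • P.root j) :
    coord b α k = coord b α i + z * coord b α j := by
  obtain ⟨c, hc, -⟩ := exists_dual_coord b hα
  rw [← hc, ← hc, ← hc, hk, map_add, map_smul, smul_eq_mul]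

theorem coord_reflectionPerm [P.IsRootSystem] {b : P.Base} {α : ι} (hα : α ∈ b.support)
    (i j : ι) :
    coord b α (P.reflectionPerm i j) = coord b α j - P.pairing j i * coord b α i := by
  have h : P.root (P.reflectionPerm i j) = P.root j + (-P.pairing j i) • P.root i := by
    rw [P.root_reflectionPerm, P.reflection_apply_root, neg_smul, sub_eq_add_neg]
  rw [coord_of_root_eq_add_smul hα h]
  ring

theorem coord_of_ne [P.IsRootSystem] {b : P.Base} {α i : ι} (hα : α ∈ b.support)
    (hi : i ∈ b.support) (hne : i ≠ α) : coord b α i = 0 := by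
  obtain ⟨c, hc, -, h0⟩ := exists_dual_coord b hα
  rw [← hc, h0 i hi hne]

theorem coord_nonneg [Finite ι] [P.IsRootSystem] [P.IsCrystallographic] {b : P.Base} {α i : ι}
    (hα : α ∈ b.support) (hi : b.IsPos i) : 0 ≤ coord b α i := by
  obtain ⟨c, hc, h1, h0⟩ := exists_dual_coord b hα
  have hs (j : ι) (hj : j ∈ b.support) : 0 ≤ c (P.root j) := by
    by_cases h : j = α
    · simp [h, h1]
    · rw [h0 j hj h]
  rw [← hc]
  refine hi.induction_on_add (p := fun i ↦ 0 ≤ c (P.root i)) hs fun i j k hk hi hj ↦ ?_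
  rw [hk, map_add]
  exact add_nonneg hi (hs j hj)

theorem isPos_of_coord_pos [Finite ι] [P.IsRootSystem] [P.IsCrystallographic] {b : P.Base}
    {α i : ι} (hα : α ∈ b.support) (hi : 0 < coord b α i) : b.IsPos i := by
  let _ := P.indexNeg
  by_contra hneg
  have h1 := coord_nonneg hα ((RootPairing.Base.IsPos.neg_iff_not b i).mpr hneg)
  rw [RootPairing.indexNeg_neg, coord_reflectionPerm hα, P.pairing_same] at h1
  linarith

theorem exists_dual_height [P.IsRootSystem] (b : P.Base) :
    ∃ h : Dual ℝ E, (∀ i, h (P.root i) = b.height i) ∧ ∀ i ∈ b.support, h (P.root i) = 1 := by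
  let h : Dual ℝ E := b.toWeightBasis.constr ℝ fun _ ↦ (1 : ℝ)
  have h1 (i : ι) (hi : i ∈ b.support) : h (P.root i) = 1 := by
    have := b.toWeightBasis.constr_basis ℝ (fun _ ↦ (1 : ℝ)) ⟨i, hi⟩
    rwa [b.toWeightBasis_apply] at this
  refine ⟨h, fun i ↦ ?_, h1⟩
  obtain ⟨c, -, -, hc⟩ := b.exists_root_eq_sum_int i
  rw [RootPairing.Base.height_eq_sum hc, hc, map_sum, Int.cast_sum]
  refine Finset.sum_congr rfl fun j hj ↦ ?_
  rw [map_zsmul, h1 j hj, zsmul_eq_mul, mul_one]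

/-! ### Strata and their subsystems -/

theorem stratum_subset_intStratum (b : P.Base) (S : Set ι) (β : ι) :
    stratum b S β ⊆ intStratum b S β :=
  fun γ hγ ↦ ⟨1, fun α hα ↦ by simpa using hγ α hα⟩

theorem support_diff_subset_intStratum [P.IsRootSystem] {b : P.Base} {S : Set ι}
    (hS : S ⊆ b.support) (β : ι) : ↑b.support \ S ⊆ intStratum b S β :=
  fun i hi ↦ ⟨0, fun α hα ↦ by
    rw [coord_of_ne (hS hα) hi.1 (by rintro rfl; exact hi.2 hα)]
    simp⟩

theorem isRootSubsystem_intStratum [P.IsRootSystem] [P.IsCrystallographic] {b : P.Base}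
    {S : Set ι} (hS : S ⊆ b.support) (β : ι) : IsRootSubsystem P (intStratum b S β) := by
  rintro i ⟨k, hk⟩ j ⟨l, hl⟩
  obtain ⟨z, hz⟩ := P.exists_value (S := ℤ) j i
  refine ⟨l - z * k, fun α hα ↦ ?_⟩
  rw [coord_reflectionPerm (hS hα), hk α hα, hl α hα, ← hz]
  simp
  ring

theorem reflection_mem_image_stratum [P.IsRootSystem] {b : P.Base} {S : Set ι}
    (hS : S ⊆ b.support) (β : ι) {i : ι} (hi : i ∈ ↑b.support \ S) {z : E}
    (hz : z ∈ P.root '' stratum b S β) : P.reflection i z ∈ P.root '' stratum b S β := by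
  obtain ⟨j, hj, rfl⟩ := hz
  refine ⟨P.reflectionPerm i j, fun α hα ↦ ?_, P.root_reflectionPerm i j⟩
  rw [coord_reflectionPerm (hS hα), hj α hα,
    coord_of_ne (hS hα) hi.1 (by rintro rfl; exact hi.2 hα)]
  simp

instance [P.IsCrystallographic] {A : Set ι} (hA : IsRootSubsystem P A) :
    (subsystem P A hA).IsCrystallographic :=
  ⟨fun i j ↦ P.exists_value (S := ℤ) (i : ι) (j : ι)⟩

instance [P.IsReduced] {A : Set ι} (hA : IsRootSubsystem P A) :
    (subsystem P A hA).IsReduced :=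
  ⟨fun i j h ↦ RootPairing.IsReduced.eq_or_eq_neg (P := P) (i : ι) (j : ι) h⟩

/-- The application of `exists_base_insert` to `Φ_{S,ℤβ}`. It covers both orientations: `β' = β` for
a positive multiple of the coordinate at a root of `S`, and `β' = -β` for a negative multiple. -/
theorem exists_isSimpleSystem_intStratum [Finite ι] [P.IsRootSystem] [P.IsCrystallographic]
    [P.IsReduced] {b : P.Base} {S : Set ι} (hS : S ⊆ b.support) {β β' : ι} (κ : Dual ℝ E)
    (hβ' : β' ∈ intStratum b S β) (hκβ' : κ (P.root β') = 1)
    (hκ : ∀ i ∈ intStratum b S β, ∃ k : ℤ, κ (P.root i) = k)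
    (hκD : ∀ i ∈ ↑b.support \ S, κ (P.root i) = 0)
    (hκS : ∀ i ∈ intStratum b S β, ∀ α ∈ S, coord b α i = κ (P.root i) * coord b α β')
    (hΨ : IsRootSubsystem P (intStratum b S β)) :
    ∃ g ∈ intStratum b S β, κ (P.root g) = 1 ∧
      IsSimpleSystem (subsystem P (intStratum b S β) hΨ)
        ({P.root g} ∪ P.root '' (↑b.support \ S)) ∧
      ∀ i ∈ intStratum b S β, κ (P.root i) = 1 →
        P.root i - P.root g ∈ AddSubmonoid.closure (P.root '' (↑b.support \ S)) := by
  obtain ⟨h, hh, hh1⟩ := exists_dual_height b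
  let Q := subsystem P (intStratum b S β) hΨ
  let D : Set (intStratum b S β) := {i | (i : ι) ∈ ↑b.support \ S}
  have hQ (i : intStratum b S β) : Q.root i = P.root i := rfl
  have hD : Q.root '' D = P.root '' (↑b.support \ S) := by
    ext x
    constructor
    · rintro ⟨i, hi, rfl⟩
      exact ⟨i, hi, rfl⟩
    · rintro ⟨i, hi, rfl⟩
      exact ⟨⟨i, support_diff_subset_intStratum hS β hi⟩, hi, rfl⟩
  have hspan (i : intStratum b S β) :
      Q.root i - κ (Q.root i) • Q.root ⟨β', hβ'⟩ ∈ Submodule.span ℝ (Q.root '' D) := by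
    rw [hD, hQ, hQ, root_eq_sum_coord b β', Finset.smul_sum]
    nth_rw 1 [root_eq_sum_coord b i]
    rw [← Finset.sum_sub_distrib]
    refine sum_mem fun α hα ↦ ?_
    -- The coordinates of `i` and of `κ i • β'` in `S` cancel, and the other terms lie in the span.
    by_cases hαS : α ∈ S
    · rw [hκS i i.2 α hαS, smul_smul, sub_self]
      exact zero_mem _
    · have hmem : P.root α ∈ Submodule.span ℝ (P.root '' (↑b.support \ S)) :=
        Submodule.subset_span ⟨α, ⟨hα, hαS⟩, rfl⟩
      exact sub_mem (Submodule.smul_mem _ _ hmem)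
        (Submodule.smul_mem _ _ (Submodule.smul_mem _ _ hmem))
  obtain ⟨g, hg1, ⟨b', hb'⟩, hg⟩ := exists_base_insert Q κ h D ⟨β', hβ'⟩
    (fun i ↦ hκ i i.2) hκβ' (fun i hi ↦ hκD i hi) (fun i hi ↦ hh1 i hi.1)
    (fun i hi ↦ by
      rw [hQ, hh] at hi ⊢
      exact_mod_cast hi)
    (fun i ↦ by
      rw [hQ, hh]
      exact_mod_cast b.height_ne_zero i) hspan
  refine ⟨g, g.2, hg1, ⟨b', ?_⟩, fun i hi hi1 ↦ ?_⟩
  · rw [hb', image_insert_eq, hD, singleton_union]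
    rfl
  · rw [← hD]
    exact hg ⟨i, hi⟩ hi1

theorem mem_span_of_mem_closure {b : P.Base} {D : Set ι} (hD : D ⊆ b.support) {x : E}
    (hx : x ∈ AddSubmonoid.closure (P.root '' D)) :
    x ∈ Submodule.span NNReal (P.root '' {i | b.IsPos i}) := by
  induction hx using AddSubmonoid.closure_induction with
  | mem x hx =>
    obtain ⟨i, hi, rfl⟩ := hx
    exact Submodule.subset_span ⟨i, RootPairing.Base.isPos_of_mem_support (hD hi), rfl⟩
  | zero => exact zero_mem _
  | add x y _ _ hx hy => exact add_mem hx hy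

theorem coord_le_of_le [Finite ι] [P.IsRootSystem] [P.IsCrystallographic] {b : P.Base}
    {x y : PosRoot b} (hxy : x ≤ y) {α : ι} (hα : α ∈ b.support) :
    coord b α x.idx ≤ coord b α y.idx := by
  obtain ⟨c, hc, -⟩ := exists_dual_coord b hα
  have key : ∀ v ∈ Submodule.span NNReal (P.root '' {i | b.IsPos i}), 0 ≤ c v := by
    intro v hv
    induction hv using Submodule.span_induction with
    | mem v hv =>
      obtain ⟨i, hi, rfl⟩ := hv
      rw [hc]
      exact coord_nonneg hα hi
    | zero => simp
    | add u v _ _ hu hv => rw [map_add]; exact add_nonneg hu hv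
    | smul a v _ hv =>
      rw [NNReal.smul_def, map_smul, smul_eq_mul]
      exact mul_nonneg a.2 hv
  have h := key _ hxy
  rw [map_sub, hc, hc] at h
  linarith

/-- If a linear form `κ` vanishes on all simple roots except `γ`, the coordinate at `γ` is
`κ` divided by `κ γ`, so the stratum of `γ` is a level set of `κ`. -/
theorem mem_stratum_singleton_iff {b : P.Base} {γ i : ι} {V : Set E} (κ : Dual ℝ E)
    (hb : P.root '' b.support = {P.root γ} ∪ V) (hγ : κ (P.root γ) ≠ 0) (hκ : ∀ v ∈ V, κ v = 0) :
    i ∈ stratum b {γ} γ ↔ κ (P.root i) = κ (P.root γ) := by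
  have hγb : γ ∈ b.support := by
    obtain ⟨j, hj, hjγ⟩ : P.root γ ∈ P.root '' b.support := by
      rw [hb]
      exact Or.inl rfl
    rwa [P.root.injective hjγ] at hj
  have key (j : ι) : κ (P.root j) = coord b γ j * κ (P.root γ) := by
    rw [map_root_eq_sum b, Finset.sum_eq_single_of_mem γ hγb]
    intro α hα hne
    have hα' : P.root α ∈ P.root '' b.support := ⟨α, hα, rfl⟩
    rw [hb] at hα'
    rcases hα' with h | h
    · exact absurd (P.root.injective h) hne
    · rw [hκ _ h, mul_zero]
  have h1 : coord b γ γ = 1 := by simpa [hγ] using key γ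
  rw [key i]
  simp [stratum, h1, hγ]

end RootStrata

open RootStrata

/-! ### Strata as intervals of the root poset -/

theorem mainTheorem2 {ι E N : Type*} [Finite ι]
    [AddCommGroup E] [Module ℝ E] [AddCommGroup N] [Module ℝ N]
    (P : RootPairing ι ℝ E N) [P.IsRootSystem] [P.IsCrystallographic] [P.IsReduced]
    [P.IsIrreducible] (b : P.Base) (S : Set ι) (hS : S ⊆ b.support) (β : ι) (hβ : b.IsPos β)
    (hβS : (RootStrata.supp b β ∩ S).Nonempty) :
    ∃ hΨ : RootStrata.IsRootSubsystem P (RootStrata.intStratum b S β),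
      ∃ m M : RootStrata.PosRoot b,
        -- `Φ_{S,β}` has minimum `m` and maximum `M` in the root poset and is an interval
        IsLeast {x : RootStrata.PosRoot b | x.idx ∈ RootStrata.stratum b S β} m ∧
        IsGreatest {x : RootStrata.PosRoot b | x.idx ∈ RootStrata.stratum b S β} M ∧
        RootStrata.stratum b S β = RootStrata.PosRoot.idx '' Set.Icc m M ∧
        -- the two simple systems of `Ψ = Φ_{S,ℤβ}`
        RootStrata.IsSimpleSystem (RootStrata.subsystem P (RootStrata.intStratum b S β) hΨ)
          ({P.root m.idx} ∪ P.root '' (b.support \ S)) ∧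
        RootStrata.IsSimpleSystem (RootStrata.subsystem P (RootStrata.intStratum b S β) hΨ)
          ({-P.root M.idx} ∪ P.root '' (b.support \ S)) ∧
        -- `m` and `M` have the same length, for every invariant form
        (∀ B : P.InvariantForm, B.form (P.root m.idx) (P.root m.idx) =
          B.form (P.root M.idx) (P.root M.idx)) ∧
        -- `Φ_{S,β} = Ψ_{{γ},γ}` for `γ = m`, with respect to the first simple system of `Ψ`
        (∀ (b' : (RootStrata.subsystem P (RootStrata.intStratum b S β) hΨ).Base)
            (γ : RootStrata.intStratum b S β),
          P.root γ = P.root m.idx →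
          (fun i : RootStrata.intStratum b S β ↦ P.root i) '' b'.support =
            {P.root γ} ∪ P.root '' (b.support \ S) →
          P.root '' RootStrata.stratum b S β =
            (fun i : RootStrata.intStratum b S β ↦ P.root i) '' RootStrata.stratum b' {γ} γ) ∧
        -- `Φ_{S,β} = -Ψ_{{γ},γ}` for `γ = -M`, with respect to the second simple system of `Ψ`
        (∀ (b' : (RootStrata.subsystem P (RootStrata.intStratum b S β) hΨ).Base)
            (γ : RootStrata.intStratum b S β),
          P.root γ = -P.root M.idx →
          (fun i : RootStrata.intStratum b S β ↦ P.root i) '' b'.support =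
            {P.root γ} ∪ P.root '' (b.support \ S) →
          P.root '' RootStrata.stratum b S β =
            (fun i : RootStrata.intStratum b S β ↦ -P.root i) '' RootStrata.stratum b' {γ} γ) := by
  obtain ⟨α₀, ⟨hα₀, hne⟩, hα₀S⟩ := hβS
  obtain ⟨c, hc, -⟩ := exists_dual_coord b hα₀
  have hpos : 0 < coord b α₀ β := lt_of_le_of_ne (coord_nonneg hα₀ hβ) (Ne.symm hne)
  let Ψ := intStratum b S β
  have hΨ : IsRootSubsystem P Ψ := isRootSubsystem_intStratum hS β
  let D : Set ι := ↑b.support \ S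
  -- The form `κ` is integral on `Ψ`, and `Φ_{S,β}` is its level set `κ = 1`.
  let κ : Module.Dual ℝ E := (coord b α₀ β)⁻¹ • c
  have hκ (i : ι) : κ (P.root i) = (coord b α₀ β)⁻¹ * coord b α₀ i := by
    rw [← hc i]
    rfl
  have hκk {i : ι} {k : ℤ} (hk : ∀ α ∈ S, coord b α i = k * coord b α β) :
      κ (P.root i) = k := by
    rw [hκ, hk α₀ hα₀S]
    field_simp
  have hβΨ : β ∈ Ψ := ⟨1, fun α _ ↦ by simp⟩
  have hκβ : κ (P.root β) = 1 := by rw [hκ, inv_mul_cancel₀ hne]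
  have hκint (i : ι) (hi : i ∈ Ψ) : ∃ k : ℤ, κ (P.root i) = k := by
    obtain ⟨k, hk⟩ := hi
    exact ⟨k, hκk hk⟩
  have hκD (i : ι) (hi : i ∈ D) : κ (P.root i) = 0 := by
    rw [hκ, coord_of_ne hα₀ hi.1 (by rintro rfl; exact hi.2 hα₀S), mul_zero]
  have hκS (i : ι) (hi : i ∈ Ψ) (α : ι) (hα : α ∈ S) :
      coord b α i = κ (P.root i) * coord b α β := by
    obtain ⟨k, hk⟩ := hi
    rw [hκk hk, hk α hα]
  have hstr (i : ι) : i ∈ stratum b S β ↔ i ∈ Ψ ∧ κ (P.root i) = 1 := by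
    refine ⟨fun hi ↦ ⟨stratum_subset_intStratum b S β hi, ?_⟩, fun ⟨hi, hi1⟩ α hα ↦ ?_⟩
    · rw [hκ, hi α₀ hα₀S, inv_mul_cancel₀ hne]
    · rw [hκS i hi α hα, hi1, one_mul]
  have hstrpos (i : ι) (hi : i ∈ stratum b S β) : b.IsPos i :=
    isPos_of_coord_pos hα₀ (by rw [hi α₀ hα₀S]; exact hpos)
  let _ := P.indexNeg
  have hnegΨ (i : ι) (hi : i ∈ Ψ) : -i ∈ Ψ := hΨ i hi i hi
  have hneg (i : ι) : P.root (-i) = -P.root i := by simp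
  -- The minimum `m` comes from `κ`; the maximum is `-g` with `g` coming from `-κ`.
  obtain ⟨m, hmΨ, hm1, hmsimple, hmle⟩ :=
    exists_isSimpleSystem_intStratum hS κ hβΨ hκβ hκint hκD hκS hΨ
  obtain ⟨g, hgΨ, hg1, hgsimple, hgle⟩ :=
    exists_isSimpleSystem_intStratum hS (β := β) (-κ) (hnegΨ β hβΨ)
      (by rw [hneg]; simpa using hκβ)
      (fun i hi ↦ by
        obtain ⟨k, hk⟩ := hκint i hi
        exact ⟨-k, by simp [hk]⟩)
      (fun i hi ↦ by simpa using hκD i hi)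
      (fun i hi α hα ↦ by
        rw [RootPairing.indexNeg_neg, coord_reflectionPerm (hS hα), P.pairing_same, hκS i hi α hα,
          LinearMap.neg_apply]
        ring) hΨ
  have hms : m ∈ stratum b S β := (hstr m).mpr ⟨hmΨ, hm1⟩
  have hMs : -g ∈ stratum b S β := (hstr (-g)).mpr ⟨hnegΨ g hgΨ, by
    rw [hneg, map_neg]
    exact hg1⟩
  have hlow (i : ι) (hi : i ∈ stratum b S β) :
      P.root i - P.root m ∈ AddSubmonoid.closure (P.root '' D) :=
    hmle i ((hstr i).mp hi).1 ((hstr i).mp hi).2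
  have hhigh (i : ι) (hi : i ∈ stratum b S β) :
      P.root (-g) - P.root i ∈ AddSubmonoid.closure (P.root '' D) := by
    have h := hgle (-i) (hnegΨ i ((hstr i).mp hi).1) (by
      rw [hneg, LinearMap.neg_apply, map_neg, neg_neg]
      exact ((hstr i).mp hi).2)
    rw [hneg] at h ⊢
    convert h using 1
    abel
  let pm : PosRoot b := ⟨m, hstrpos m hms⟩
  let pM : PosRoot b := ⟨-g, hstrpos (-g) hMs⟩
  have hpm (x : PosRoot b) (hx : x.idx ∈ stratum b S β) : pm ≤ x :=
    mem_span_of_mem_closure Set.sdiff_subset (hlow x.idx hx)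
  have hpM (x : PosRoot b) (hx : x.idx ∈ stratum b S β) : x ≤ pM :=
    mem_span_of_mem_closure Set.sdiff_subset (hhigh x.idx hx)
  have hκV : ∀ v ∈ P.root '' D, κ v = 0 := by
    rintro - ⟨i, hi, rfl⟩
    exact hκD i hi
  refine ⟨hΨ, pm, pM, ⟨hms, hpm⟩, ⟨hMs, hpM⟩, ?_, hmsimple, ?_, fun B ↦ ?_, ?_, ?_⟩
  · ext i
    refine ⟨fun hi ↦ ⟨⟨i, hstrpos i hi⟩, ⟨hpm _ hi, hpM _ hi⟩, rfl⟩, ?_⟩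
    rintro ⟨x, ⟨h1, h2⟩, rfl⟩ α hα
    have e1 := coord_le_of_le h1 (hS hα)
    have e2 := coord_le_of_le h2 (hS hα)
    have e3 : coord b α pm.idx = coord b α β := hms α hα
    have e4 : coord b α pM.idx = coord b α β := hMs α hα
    linarith
  · have e : -P.root pM.idx = P.root g := by
      change -P.root (-g) = _
      rw [hneg, neg_neg]
    rw [e]
    exact hgsimple
  · obtain ⟨h, -, hh⟩ := exists_dual_height b
    refine form_eq_of_least_of_greatest B h (D := D) (Z := P.root '' stratum b S β)
      (fun i hi ↦ by rw [hh i hi.1]; exact one_pos) (Set.toFinite _)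
      (fun i hi z hz ↦ reflection_mem_image_stratum hS β hi hz) ⟨m, hms, rfl⟩ ⟨-g, hMs, rfl⟩ ?_ ?_
    · rintro - ⟨i, hi, rfl⟩
      exact hlow i hi
    · rintro - ⟨i, hi, rfl⟩
      exact hhigh i hi
  · intro b' γ hγ hb'
    have hγ1 : κ (P.root γ) = 1 := by rw [hγ]; exact hm1
    have key (i : Ψ) : i ∈ stratum b' {γ} γ ↔ κ (P.root i) = κ (P.root γ) :=
      mem_stratum_singleton_iff κ hb' (hγ1.trans_ne one_ne_zero) hκV
    ext x
    constructor
    · rintro ⟨i, hi, rfl⟩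
      refine ⟨⟨i, ((hstr i).mp hi).1⟩, (key _).mpr ?_, rfl⟩
      rw [hγ1]
      exact ((hstr i).mp hi).2
    · rintro ⟨i, hi, rfl⟩
      exact ⟨i, (hstr i).mpr ⟨i.2, ((key i).mp hi).trans hγ1⟩, rfl⟩
  · intro b' γ hγ hb'
    have hγ1 : κ (P.root γ) = -1 := by
      rw [hγ, map_neg]
      exact congrArg Neg.neg ((hstr (-g)).mp hMs).2
    have key (i : Ψ) : i ∈ stratum b' {γ} γ ↔ κ (P.root i) = κ (P.root γ) :=
      mem_stratum_singleton_iff κ hb' (hγ1.trans_ne (by norm_num)) hκV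
    ext x
    constructor
    · rintro ⟨i, hi, rfl⟩
      refine ⟨⟨-i, hnegΨ i ((hstr i).mp hi).1⟩, (key _).mpr ?_, ?_⟩
      · rw [hγ1, hneg, map_neg, ((hstr i).mp hi).2]
      · change -P.root (-i) = _
        rw [hneg, neg_neg]
    · rintro ⟨i, hi, rfl⟩
      refine ⟨-i, (hstr _).mpr ⟨hnegΨ i i.2, ?_⟩, hneg i⟩
      rw [hneg, map_neg, (key i).mp hi, hγ1, neg_neg]
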